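/- **Theorem A (Form of projectable functions).** Let $\widehat{\mathbb C}=\mathbb C\cup\{\infty\}$, and for $\tau\in\mathbb C\setminus\{0\}$ put $\exp_\tau(z)=e^{2\pi i z/\tau}$. A transcendental (that is, non-rational) meromorphic function $f:\mathbb C\to\widehat{\mathbb C}$ is called *projectable via $\exp_\tau$* if there is a function $g$ with $g(\exp_\tau(z))=\exp_\tau(f(z))$ for all $z$ with $f(z)\neq\infty$. A meromorphic function $f:\mathbb C\to\widehat{\mathbb C}$ is called *pseudoperiodic* with respect to a lattice $\Lambda\subset\mathbb C$ (either $\Lambda=\tau_1\mathbb Z$ with $\tau_1\ne0$, or $\Lambda=\tau_1\mathbb Z+\tau_2\mathbb Z$ with $\operatorname{Im}(\tau_2/\tau_1)>0$) if for each $\lambda\in\Lambda$ there is $\eta_\lambda\in\mathbb C$ with $f(z+\lambda)=f(z)+\eta_\lambda$ for all $z$; it is *doubly pseudoperiodic* if this holds for some lattice of rank two. Affine maps are the maps $z\mapsto az+b$ with $a,b\in\mathbb C$, constants included. 1. A function $f:\mathbb C\to\widehat{\mathbb C}$ is projectable via $\exp_1$ if and only if $f$ is pseudoperiodic (with respect to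 some lattice), is not affine, and satisfies, for some $\ell\in\mathbb Z$, $f(z+1)=f(z)+\ell$ for all $z$. 2. Every $f$ projectable via $\exp_1$ can be written as $$f(z)=\ell z+\Phi(e^{2\pi i z})\quad\text{for all } z\in\mathbb C,$$ where $\ell\in\mathbb Z$, $\Phi$ is a non-constant meromorphic function on $\mathbb C^*=\mathbb C\setminus\{0\}$, and $\ell$ is the integer with $f(z+1)=f(z)+\ell$ for all $z$. The pair $(\ell,\Phi)$ is unique. 3. Let $f$ be projectable via $\exp_1$, with $\ell,\Phi$ as in 2. For all $\tau$ with $\operatorname{Im}\tau>0$ and all $\eta_\tau\in\mathbb C$, one has $f(z+\tau)=f(z)+\eta_\tau$ for all $z$ if and only if $$\Phi(e^{2\pi i z})=\frac{\ell\tau-\eta_\tau}{2\pi i}\Big(\zeta(z)-2\,\zeta\big(\tfrac12\big)\,z\Big)+E(z)$$ as meromorphic functions of $z$, for some meromorphic function $E$ on $\mathbb C$ with periods $1$ and $\tau$ (possibly constant), where $$\zeta(z)=\frac1z+\sum_{\lambda\in(\mathbb Z+\tau\mathbb Z)\setminus\{0\}}\Big(\frac1{z-\lambda}+\frac1\lambda+\frac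 z{\lambda^2}\Big)$$ is the Weierstrass $\zeta$-function of $\mathbb Z+\tau\mathbb Z$. In particular, $f$ is doubly pseudoperiodic if and only if $\Phi$ has this form for some $\tau$ with $\operatorname{Im}\tau>0$ and some $\eta_\tau\in\mathbb C$. 4. If $f$ is projectable via $\exp_1$ and, for some $\tau$ with $\operatorname{Im}\tau>0$, one has $f(z+\tau)=f(z)+L\tau$ for all $z$ with some $L\in\mathbb Z$, then $f$ is also projectable via $\exp_\tau$. -/

import Mathlib

open Topology Filter

namespace PseudoPer

/-- `f` is meromorphic at `z₀` as a map into the Riemann sphere `OnePoint ℂ`: near `z₀`, away from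
`z₀` itself, it is finite and given by a meromorphic function, and it is continuous at `z₀`
(so that poles are exactly the points with value `∞`). -/
def IsMeromorphicAt (f : ℂ → OnePoint ℂ) (z₀ : ℂ) : Prop :=
  (∃ h : ℂ → ℂ, MeromorphicAt h z₀ ∧ ∀ᶠ z in 𝓝[≠] z₀, f z = (h z : OnePoint ℂ)) ∧
    ContinuousAt f z₀

/-- `f` is meromorphic on the set `U`, as a map into the Riemann sphere. -/
def IsMeromorphicOn (f : ℂ → OnePoint ℂ) (U : Set ℂ) : Prop :=
  ∀ z ∈ U, IsMeromorphicAt f z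

/-- `f` is a rational function. -/
def IsRational (f : ℂ → OnePoint ℂ) : Prop :=
  ∃ P Q : Polynomial ℂ, Q ≠ 0 ∧
    ∀ z : ℂ, Q.eval z ≠ 0 → f z = ((P.eval z / Q.eval z : ℂ) : OnePoint ℂ)

/-- A transcendental meromorphic function on `ℂ`: meromorphic and not rational. -/
def IsTranscendentalMeromorphic (f : ℂ → OnePoint ℂ) : Prop :=
  IsMeromorphicOn f Set.univ ∧ ¬ IsRational f

/-- `f` is affine, `f z = a z + b` (constant maps `a = 0` are included). -/
def IsAffine (f : ℂ → OnePoint ℂ) : Prop :=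
  ∃ a b : ℂ, ∀ z : ℂ, f z = ((a * z + b : ℂ) : OnePoint ℂ)

/-- The exponential of period `τ`, `z ↦ exp (2 π i z / τ)`. -/
noncomputable def expPer (τ z : ℂ) : ℂ :=
  Complex.exp (2 * Real.pi * Complex.I * z / τ)

/-- `f` is projectable via `expPer τ`: it is transcendental meromorphic and there is a function `g`
with `g ∘ expPer τ = expPer τ ∘ f` wherever the right-hand side is defined, that is, at all points
at which `f` has a finite value `c`. -/
def IsProjectable (τ : ℂ) (f : ℂ → OnePoint ℂ) : Prop :=
  IsTranscendentalMeromorphic f ∧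
    ∃ g : ℂ → ℂ, ∀ z c : ℂ, f z = (c : OnePoint ℂ) → g (expPer τ z) = expPer τ c

/-- The sum of a point of the Riemann sphere and a finite number, with `∞ + c = ∞`. -/
def addFin (p : OnePoint ℂ) (c : ℂ) : OnePoint ℂ :=
  p.map (fun x => x + c)

/-- `f (z + τ) = f z + η` for all `z`. -/
def HasPseudoperiod (f : ℂ → OnePoint ℂ) (τ η : ℂ) : Prop :=
  ∀ z : ℂ, f (z + τ) = addFin (f z) η

/-- Lattices in `ℂ` of rank one, `τ₁ ℤ` with `τ₁ ≠ 0`, or of rank two, `τ₁ ℤ + τ₂ ℤ` with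
`τ₂ / τ₁` in the upper half plane. -/
def IsLatticeInC (Λ : Submodule ℤ ℂ) : Prop :=
  (∃ τ₁ : ℂ, τ₁ ≠ 0 ∧ Λ = Submodule.span ℤ {τ₁}) ∨
    (∃ τ₁ τ₂ : ℂ, 0 < (τ₂ / τ₁).im ∧ Λ = Submodule.span ℤ {τ₁, τ₂})

/-- `f` is meromorphic and pseudoperiodic with respect to `Λ`. -/
def IsPseudoperiodicWrt (f : ℂ → OnePoint ℂ) (Λ : Submodule ℤ ℂ) : Prop :=
  IsMeromorphicOn f Set.univ ∧ ∀ τ ∈ Λ, ∃ η : ℂ, HasPseudoperiod f τ η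

/-- `f` is pseudoperiodic (with respect to some lattice of rank one or two). -/
def IsPseudoperiodic (f : ℂ → OnePoint ℂ) : Prop :=
  ∃ Λ : Submodule ℤ ℂ, IsLatticeInC Λ ∧ IsPseudoperiodicWrt f Λ

/-- `f` is doubly pseudoperiodic: pseudoperiodic with respect to a lattice of rank two. -/
def IsDoublyPseudoperiodic (f : ℂ → OnePoint ℂ) : Prop :=
  ∃ τ₁ τ₂ : ℂ, 0 < (τ₂ / τ₁).im ∧ IsPseudoperiodicWrt f (Submodule.span ℤ {τ₁, τ₂})

/-- `f z = ℓ z + Φ (exp (2 π i z))` for all `z`, with `Φ` meromorphic and non-constant on `ℂ ∖ {0}`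
(the value of `Φ` at `0` plays no role). -/
def HasForm (f : ℂ → OnePoint ℂ) (ℓ : ℤ) (Φ : ℂ → OnePoint ℂ) : Prop :=
  IsMeromorphicOn Φ {0}ᶜ ∧ (¬ ∃ c : OnePoint ℂ, ∀ w : ℂ, w ≠ 0 → Φ w = c) ∧
    ∀ z : ℂ, f z = addFin (Φ (expPer 1 z)) ((ℓ : ℂ) * z)

/-- The lattice `ℤ + τ ℤ`. -/
def latticeOneTau (τ : ℂ) : Submodule ℤ ℂ := Submodule.span ℤ {1, τ}

/-- The Weierstrass zeta function of the lattice `Λ` (at points outside `Λ`). -/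
noncomputable def weierstrassZeta (Λ : Submodule ℤ ℂ) (z : ℂ) : ℂ :=
  1 / z + ∑' l : {l : ℂ // l ∈ Λ ∧ l ≠ 0}, (1 / (z - l) + 1 / (l : ℂ) + z / (l : ℂ) ^ 2)

/-- The identity of meromorphic functions
`Φ (exp (2 π i z)) = (ℓ τ - η) / (2 π i) * (ζ z - 2 ζ (1/2) z) + E z`, where `ζ` belongs to
`ℤ + τ ℤ` and `E` is a meromorphic function with periods `1` and `τ`. It is imposed at the points
outside `ℤ + τ ℤ`, where `ζ` is finite and the sum in the Riemann sphere makes sense pointwise. -/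
def HasDoublyForm (ℓ : ℤ) (Φ : ℂ → OnePoint ℂ) (τ η : ℂ) : Prop :=
  ∃ E : ℂ → OnePoint ℂ, IsMeromorphicOn E Set.univ ∧
    Function.Periodic E 1 ∧ Function.Periodic E τ ∧
    ∀ z : ℂ, z ∉ latticeOneTau τ →
      Φ (expPer 1 z) = addFin (E z)
        (((ℓ : ℂ) * τ - η) / (2 * Real.pi * Complex.I) *
          (weierstrassZeta (latticeOneTau τ) z -
            2 * weierstrassZeta (latticeOneTau τ) (1 / 2) * z))

end PseudoPer

/-! Projectability via `exp_1` forces `f (z + 1) - f z` to be an integer wherever both values are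
finite. The poles are countable, so what remains of the plane is connected and dense; the integer is
constant there, and continuity into the sphere gives `f (z + 1) = f z + ℓ` everywhere. Conversely,
such a relation makes `exp_1 ∘ f` constant on the fibres of `exp_1`, and a rational function
satisfying it is affine. The same fibre argument with `τ` in place of `1` gives projectability via
`exp_τ`.

Since `f z - ℓ z` has period `1`, it descends through the exponential to `Φ`, which is meromorphic
because the exponential has local analytic inverses.

For a second pseudoperiod `τ`, the function `Z z = ζ z - 2 ζ(1/2) z` has period `1` and drops by
`2πi` under `τ` (`weierstrassZeta_add_one`, `weierstrassZeta_add_tau`), while `f z - ℓ z` changes by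
`η - ℓ τ`. Subtracting `(ℓ τ - η) / (2πi)` times `Z` therefore leaves an elliptic function exactly
when `η` is the pseudoperiod. The analytic work is this Legendre relation, proved by summing `ζ` row
by row over `m τ + n`, with cotangents arising from the rows. -/

namespace PseudoPer

/-! ### Convergence, analyticity and oddness of the Weierstrass zeta function -/

section Zeta

variable (L : PeriodPair)

/-- The summand of the Weierstrass zeta function; at `l = 0` it is `1 / z`. -/
noncomputable def zetaTerm (z l : ℂ) : ℂ := 1 / (z - l) + 1 / l + z / l ^ 2

lemma zetaTerm_zero (z : ℂ) : zetaTerm z 0 = 1 / z := by simp [zetaTerm]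

lemma zetaTerm_neg (z l : ℂ) : zetaTerm (-z) (-l) = -zetaTerm z l := by
  have : -z - -l = -(z - l) := by ring
  rw [zetaTerm, zetaTerm, this, div_neg, div_neg, neg_sq, neg_div]
  ring

/-- The three fractions combine to `z ^ 2 / ((z - l) * l ^ 2)`, of cubic decay in `l`, which is
summable over a lattice of rank two. -/
lemma norm_zetaTerm_le {r : ℝ} (hr : 0 < r) {z l : ℂ} (hz : ‖z‖ < r) (hl : 2 * r ≤ ‖l‖) :
    ‖zetaTerm z l‖ ≤ 2 * r ^ 2 * ‖l‖ ^ (-3 : ℝ) := by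
  have hl0 : 0 < ‖l‖ := by linarith
  have h1 : ‖l‖ / 2 ≤ ‖z - l‖ := by
    rw [norm_sub_rev]
    exact .trans (by linarith) (norm_sub_norm_le l z)
  have h2 : z - l ≠ 0 := by
    rw [← norm_pos_iff]; linarith
  have h3 : l ≠ 0 := norm_pos_iff.mp hl0
  have e : zetaTerm z l = z ^ 2 / ((z - l) * l ^ 2) := by
    rw [zetaTerm]; field_simp; ring
  calc ‖zetaTerm z l‖ = ‖z‖ ^ 2 / (‖z - l‖ * ‖l‖ ^ 2) := by rw [e]; simp
    _ ≤ r ^ 2 / (‖l‖ / 2 * ‖l‖ ^ 2) := by gcongr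
    _ = 2 * r ^ 2 / ‖l‖ ^ 3 := by field_simp
    _ = _ := by norm_cast

open Classical in
/-- The Weierstrass zeta function without its pole at `0`. -/
noncomputable def zetaReg (z : ℂ) : ℂ :=
  ∑' l : L.lattice, if (l : ℂ) = 0 then 0 else zetaTerm z l

open Classical in
lemma hasSumLocallyUniformly_zetaReg :
    HasSumLocallyUniformly
      (fun (l : L.lattice) (z : ℂ) ↦ if (l : ℂ) = 0 then 0 else zetaTerm z l) (zetaReg L) := by
  refine L.hasSumLocallyUniformly_aux (u := fun r l ↦ 2 * r ^ 2 * ‖l‖ ^ (-3 : ℝ)) _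
    (fun _ _ ↦ (ZLattice.summable_norm_rpow _ _ (by simp; norm_num)).mul_left _) fun r hr ↦
    Filter.eventually_atTop.mpr ⟨2 * r, ?_⟩
  rintro _ h s hs l rfl
  split_ifs
  · rw [norm_zero]; positivity
  · exact norm_zetaTerm_le hr hs h

lemma differentiableOn_zetaReg :
    DifferentiableOn ℂ (zetaReg L) (L.lattice \ {0})ᶜ := by
  classical
  refine (hasSumLocallyUniformly_zetaReg L).hasSumLocallyUniformlyOn.differentiableOn
    (.of_forall fun s ↦ .fun_sum fun i hi ↦ ?_) L.isOpen_compl_lattice_sdiff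
  split_ifs with h
  · simp
  · unfold zetaTerm
    refine .add (.add (.div (by fun_prop) (by fun_prop) ?_) (by fun_prop)) (by fun_prop)
    intro x hx h0
    rw [sub_eq_zero] at h0
    exact hx ⟨h0 ▸ i.2, by rw [h0]; exact h⟩

lemma weierstrassZeta_eq_add_zetaReg (z : ℂ) :
    weierstrassZeta L.lattice z = 1 / z + zetaReg L z := by
  classical
  rw [weierstrassZeta, zetaReg]
  congr 1
  have h1 := tsum_subtype {l : ℂ | l ∈ L.lattice ∧ l ≠ 0} (zetaTerm z)
  have h2 := tsum_subtype (L.lattice : Set ℂ) (fun l ↦ if l = 0 then 0 else zetaTerm z l)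
  refine h1.trans (Eq.trans (tsum_congr fun l ↦ ?_) h2.symm)
  by_cases hl : l ∈ L.lattice <;> by_cases h0 : l = 0 <;> simp [Set.indicator, hl, h0]

/-- Because `1 / 0 = 0`, the term at `l = 0` is the principal part `1 / z`, so the sum runs over the
whole lattice and can be reindexed freely. -/
lemma hasSum_weierstrassZeta (z : ℂ) :
    HasSum (fun l : L.lattice ↦ zetaTerm z l) (weierstrassZeta L.lattice z) := by
  classical
  rw [weierstrassZeta_eq_add_zetaReg]
  have h1 := (hasSumLocallyUniformly_zetaReg L).hasSum (x := z)
  have h2 : HasSum (fun l : L.lattice ↦ if l = 0 then 1 / z else 0) (1 / z) :=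
    hasSum_ite_eq 0 (1 / z)
  convert h2.add h1 using 2 with l
  by_cases h : l = 0
  · simp [h, zetaTerm_zero]
  · simp [h]

lemma weierstrassZeta_neg (z : ℂ) :
    weierstrassZeta L.lattice (-z) = -weierstrassZeta L.lattice z := by
  have h := (Equiv.neg L.lattice).hasSum_iff.mpr (hasSum_weierstrassZeta L (-z))
  refine h.unique ?_
  convert! (hasSum_weierstrassZeta L z).neg using 2 with l
  simp [zetaTerm_neg]

end Zeta

/-! ### Symmetric partial sums and the cotangent series -/

section SymmetricSums

lemma sum_Icc_neg_succ {M : Type*} [AddCommGroup M] (f : ℤ → M) (N : ℕ) :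
    ∑ n ∈ Finset.Icc (-((N + 1 : ℕ) : ℤ)) ((N + 1 : ℕ) : ℤ), f n =
      (∑ n ∈ Finset.Icc (-(N : ℤ)) (N : ℤ), f n) + (f (N + 1) + f (-(N + 1))) := by
  have : Finset.Icc (-((N + 1 : ℕ) : ℤ)) ((N + 1 : ℕ) : ℤ) =
      insert ((N : ℤ) + 1) (insert (-((N : ℤ) + 1)) (Finset.Icc (-(N : ℤ)) (N : ℤ))) := by
    ext x; simp only [Finset.mem_Icc, Finset.mem_insert]; push_cast; omega
  rw [this, Finset.sum_insert, Finset.sum_insert]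
  · abel
  · simp
  · simp only [Finset.mem_insert, Finset.mem_Icc]; omega

lemma sum_Icc_neg_telescope {M : Type*} [AddCommGroup M] (f : ℤ → M) (N : ℕ) :
    ∑ n ∈ Finset.Icc (-(N : ℤ)) (N : ℤ), (f (n - 1) - f n) = f (-N - 1) - f N := by
  induction N with
  | zero => simp
  | succ N ih =>
    rw [sum_Icc_neg_succ, ih]
    have h1 : (N : ℤ) + 1 - 1 = N := by ring
    have h2 : -((N : ℤ) + 1) = -N - 1 := by ring
    push_cast
    rw [h1, h2]
    abel

lemma tendsto_sum_Icc_neg {f : ℤ → ℂ} {a : ℂ} (h : HasSum f a) :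
    Tendsto (fun N : ℕ ↦ ∑ n ∈ Finset.Icc (-(N : ℤ)) (N : ℤ), f n) atTop (𝓝 a) :=
  (show Tendsto (fun s : Finset ℤ ↦ ∑ n ∈ s, f n) atTop (𝓝 a) by simpa [HasSum] using h).comp
    Finset.tendsto_Icc_neg

open Complex in
-- Pairing `n` with `-n` turns the symmetric sum into Euler's cotangent expansion. Symmetric sums
-- are essential: the series is not absolutely convergent.
lemma tendsto_sum_inv_sub_cot {x : ℂ} (hx : x ∈ integerComplement) :
    Tendsto (fun N : ℕ ↦ ∑ n ∈ Finset.Icc (-(N : ℤ)) (N : ℤ), 1 / (x - n)) atTop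
      (𝓝 (Real.pi * cot (Real.pi * x))) := by
  have h := (tendsto_logDeriv_euler_cot_sub hx).const_add (1 / x)
  rw [add_sub_cancel] at h
  refine h.congr fun N ↦ ?_
  induction N with
  | zero => simp
  | succ N ih =>
    rw [sum_Icc_neg_succ, Finset.sum_range_succ, ← add_assoc, ih]
    congr 1
    simp only [cotTerm]
    push_cast
    rw [sub_neg_eq_add]

open Complex in
-- The cotangent is a Möbius function of `q = exp (2πi u)`, and `q → 0` as `Im u → +∞`.
lemma tendsto_cot_pi_mul_neg_I {ι : Type*} {l : Filter ι} {u : ι → ℂ}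
    (hu : Tendsto (fun i ↦ (u i).im) l atTop) :
    Tendsto (fun i ↦ cot (Real.pi * u i)) l (𝓝 (-I)) := by
  have hq : Tendsto (fun i ↦ exp (2 * Real.pi * I * u i)) l (𝓝 0) := by
    rw [tendsto_zero_iff_norm_tendsto_zero]
    simp only [Complex.norm_exp]
    refine Real.tendsto_exp_atBot.comp ?_
    have : ∀ i, (2 * Real.pi * I * u i).re = -(2 * Real.pi) * (u i).im := by intro i; simp
    simp only [this]
    exact hu.const_mul_atTop_of_neg (by have := Real.pi_pos; linarith)
  have h := (hq.add_const 1).div ((hq.const_sub 1).const_mul I) (by simp)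
  simp only [Complex.cot_pi_eq_exp_ratio]
  convert! h using 2
  simp [Complex.inv_I]

open Complex in
lemma tendsto_cot_pi_mul_I {ι : Type*} {l : Filter ι} {u : ι → ℂ}
    (hu : Tendsto (fun i ↦ (u i).im) l atBot) :
    Tendsto (fun i ↦ cot (Real.pi * u i)) l (𝓝 I) := by
  have h := (tendsto_cot_pi_mul_neg_I (u := fun i ↦ -u i) (l := l)
    (by simp only [neg_im]; exact tendsto_neg_atBot_atTop.comp hu)).neg
  rw [neg_neg] at h
  refine h.congr fun i ↦ ?_
  rw [mul_neg, Complex.cot, Complex.cot, Complex.cos_neg, Complex.sin_neg, div_neg, neg_neg]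

end SymmetricSums

/-! ### Quasi-periods of zeta and the Legendre relation -/

section QuasiPeriods

variable {τ : ℂ}

/-- The period pair `1, τ`. -/
def oneTauPair (hτ : 0 < τ.im) : PeriodPair where
  ω₁ := 1
  ω₂ := τ
  indep := by
    rw [LinearIndependent.pair_iff]
    intro s t h
    have h2 := congrArg Complex.im h
    have h1 := congrArg Complex.re h
    simp at h1 h2
    have ht : t = 0 := h2.resolve_right hτ.ne'
    subst ht
    simpa using h1

lemma lattice_oneTauPair (hτ : 0 < τ.im) : (oneTauPair hτ).lattice = latticeOneTau τ := rfl

lemma mem_latticeOneTau {z : ℂ} : z ∈ latticeOneTau τ ↔ ∃ n m : ℤ, n + m * τ = z := by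
  simp only [latticeOneTau, Submodule.mem_span_pair, zsmul_eq_mul, mul_one]

lemma one_mem_latticeOneTau : (1 : ℂ) ∈ latticeOneTau τ := Submodule.subset_span (by simp)

lemma tau_mem_latticeOneTau : τ ∈ latticeOneTau τ := Submodule.subset_span (by simp)

lemma sub_mul_mem_integerComplement {z : ℂ} (hz : z ∉ latticeOneTau τ) (m : ℤ) :
    z - m * τ ∈ Complex.integerComplement := by
  rw [Complex.mem_integerComplement_iff]
  rintro ⟨n, hn⟩
  exact hz (mem_latticeOneTau.mpr ⟨n, m, by rw [hn]; ring⟩)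

lemma hasSum_zetaTerm_prod (hτ : 0 < τ.im) (z : ℂ) :
    HasSum (fun p : ℤ × ℤ ↦ zetaTerm z (p.1 * τ + p.2))
      (weierstrassZeta (latticeOneTau τ) z) := by
  have h := ((oneTauPair hτ).latticeEquivProd.toEquiv.symm.hasSum_iff).mpr
    (hasSum_weierstrassZeta (oneTauPair hτ) z)
  rw [← (Equiv.prodComm ℤ ℤ).hasSum_iff] at h
  refine h.congr_fun ?_
  rintro ⟨m, n⟩
  have := (oneTauPair hτ).latticeEquiv_symm_apply (n, m)
  simp only [Function.comp, Equiv.prodComm_apply, Prod.swap]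
  erw [this]
  simp [oneTauPair, add_comm]

/-- The part of the zeta function coming from the lattice points `m τ + n` with fixed `m`. -/
noncomputable def zetaRow (τ : ℂ) (m : ℤ) (z : ℂ) : ℂ := ∑' n : ℤ, zetaTerm z (m * τ + n)

lemma hasSum_zetaRow (hτ : 0 < τ.im) (m : ℤ) (z : ℂ) :
    HasSum (fun n : ℤ ↦ zetaTerm z (m * τ + n)) (zetaRow τ m z) :=
  ((hasSum_zetaTerm_prod hτ z).summable.prod_factor m).hasSum

lemma hasSum_sum_zetaRow (hτ : 0 < τ.im) (z : ℂ) :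
    HasSum (fun m : ℤ ↦ zetaRow τ m z) (weierstrassZeta (latticeOneTau τ) z) :=
  (hasSum_zetaTerm_prod hτ z).prod_fiberwise fun m ↦ hasSum_zetaRow hτ m z

lemma tendsto_inv_const_sub_natCast (w : ℂ) :
    Tendsto (fun N : ℕ ↦ 1 / (w - (N : ℂ))) atTop (𝓝 0) := by
  simp only [one_div]
  exact tendsto_inv₀_cobounded.comp
    ((tendsto_const_sub_cobounded w).comp tendsto_natCast_atTop_cobounded)

lemma tendsto_inv_const_add_natCast (w : ℂ) :
    Tendsto (fun N : ℕ ↦ 1 / (w + (N : ℂ))) atTop (𝓝 0) := by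
  simp only [one_div]
  exact tendsto_inv₀_cobounded.comp
    ((tendsto_const_add_cobounded w).comp tendsto_natCast_atTop_cobounded)

/-- In the row difference the `1 / l` cancel and the `1 / (z - l)` telescope to boundary terms
tending to `0`. Only the sum of `1 / l ^ 2` survives, so the limit does not depend on `z`. All of
this is formal in `1 / 0 = 0`, so `z` may be a lattice point. -/
lemma tendsto_sum_inv_sq (hτ : 0 < τ.im) (m : ℤ) (z : ℂ) :
    Tendsto (fun N : ℕ ↦ ∑ n ∈ Finset.Icc (-(N : ℤ)) (N : ℤ), 1 / (m * τ + n : ℂ) ^ 2) atTop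
      (𝓝 (zetaRow τ m (z + 1) - zetaRow τ m z)) := by
  have h1 := tendsto_sum_Icc_neg ((hasSum_zetaRow hτ m (z + 1)).sub (hasSum_zetaRow hτ m z))
  have h2 := (tendsto_inv_const_add_natCast (z - m * τ + 1)).sub
    (tendsto_inv_const_sub_natCast (z - m * τ))
  have h3 := h1.sub h2
  rw [sub_zero, sub_zero] at h3
  refine h3.congr fun N ↦ ?_
  have h4 := sum_Icc_neg_telescope (fun n : ℤ ↦ 1 / (z - m * τ - n)) N
  have h5 : 1 / (z - m * τ + 1 + (N : ℂ)) - 1 / (z - m * τ - N) =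
      ∑ n ∈ Finset.Icc (-(N : ℤ)) (N : ℤ),
        (1 / (z - m * τ - ((n - 1 : ℤ) : ℂ)) - 1 / (z - m * τ - n)) := by
    rw [h4]; push_cast; congr 2; ring
  rw [h5, ← Finset.sum_sub_distrib]
  refine Finset.sum_congr rfl fun n _ ↦ ?_
  have e1 : z + 1 - (m * τ + n) = z - m * τ - ((n - 1 : ℤ) : ℂ) := by push_cast; ring
  have e2 : z - (m * τ + n) = z - m * τ - n := by ring
  rw [zetaTerm, zetaTerm, e1, e2]
  ring

/-- A shift by `τ` moves each row onto its neighbour, so the `1 / (z - l)` parts give a difference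
of two cotangents, and the linear parts give `τ` times the sum of `1 / l ^ 2`. -/
lemma zetaRow_add_tau (hτ : 0 < τ.im) (m : ℤ) {z : ℂ} (hz : z ∉ latticeOneTau τ) :
    zetaRow τ m (z + τ) - zetaRow τ m z =
      Real.pi * Complex.cot (Real.pi * (z - (m - 1 : ℤ) * τ)) -
        Real.pi * Complex.cot (Real.pi * (z - m * τ)) +
      τ * (zetaRow τ m (z + 1) - zetaRow τ m z) := by
  have h1 := tendsto_sum_Icc_neg ((hasSum_zetaRow hτ m (z + τ)).sub (hasSum_zetaRow hτ m z))
  have h2 := ((tendsto_sum_inv_sub_cot (sub_mul_mem_integerComplement hz (m - 1))).sub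
    (tendsto_sum_inv_sub_cot (sub_mul_mem_integerComplement hz m))).add
      ((tendsto_sum_inv_sq hτ m z).const_mul τ)
  refine tendsto_nhds_unique h1 (h2.congr fun N ↦ ?_)
  rw [← Finset.sum_sub_distrib, Finset.mul_sum, ← Finset.sum_add_distrib]
  refine Finset.sum_congr rfl fun n _ ↦ ?_
  have e1 : z + τ - (m * τ + n) = z - ((m - 1 : ℤ) : ℂ) * τ - n := by push_cast; ring
  have e2 : z - (m * τ + n) = z - m * τ - n := by ring
  rw [zetaTerm, zetaTerm, e1, e2]
  ring

lemma weierstrassZeta_add_one_sub (hτ : 0 < τ.im) (z w : ℂ) :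
    weierstrassZeta (latticeOneTau τ) (z + 1) - weierstrassZeta (latticeOneTau τ) z =
      weierstrassZeta (latticeOneTau τ) (w + 1) - weierstrassZeta (latticeOneTau τ) w := by
  refine ((hasSum_sum_zetaRow hτ (z + 1)).sub (hasSum_sum_zetaRow hτ z)).unique ?_
  convert (hasSum_sum_zetaRow hτ (w + 1)).sub (hasSum_sum_zetaRow hτ w) using 2 with m
  exact tendsto_nhds_unique (tendsto_sum_inv_sq hτ m z) (tendsto_sum_inv_sq hτ m w)

theorem weierstrassZeta_add_one (hτ : 0 < τ.im) (z : ℂ) :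
    weierstrassZeta (latticeOneTau τ) (z + 1) =
      weierstrassZeta (latticeOneTau τ) z + 2 * weierstrassZeta (latticeOneTau τ) (1 / 2) := by
  -- The increment is constant; at `-1/2` oddness evaluates it as `2 ζ(1/2)`.
  have h := weierstrassZeta_add_one_sub hτ z (-(1 / 2))
  have h2 := weierstrassZeta_neg (oneTauPair hτ) (1 / 2)
  rw [lattice_oneTauPair] at h2
  rw [h2, show -(1 / 2 : ℂ) + 1 = 1 / 2 by norm_num] at h
  linear_combination h

/-- The Legendre relation for the lattice `ℤ + τ ℤ`. -/
theorem weierstrassZeta_add_tau (hτ : 0 < τ.im) {z : ℂ} (hz : z ∉ latticeOneTau τ) :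
    weierstrassZeta (latticeOneTau τ) (z + τ) =
      weierstrassZeta (latticeOneTau τ) z +
        2 * weierstrassZeta (latticeOneTau τ) (1 / 2) * τ - 2 * Real.pi * Complex.I := by
  -- Subtracting `τ` times the increment under `1` removes the `1 / l ^ 2` sums. The cotangents left
  -- over telescope in `m`, and their limits `-πi` and `πi` at the two ends produce `-2πi`.
  have h1 := tendsto_sum_Icc_neg
    (((hasSum_sum_zetaRow hτ (z + τ)).sub (hasSum_sum_zetaRow hτ z)).sub
    (((hasSum_sum_zetaRow hτ (z + 1)).sub (hasSum_sum_zetaRow hτ z)).mul_left τ))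
  have hlim : Tendsto (fun M : ℕ ↦ τ.im * (M : ℝ)) atTop atTop :=
    tendsto_natCast_atTop_atTop.const_mul_atTop hτ
  have h2 : Tendsto (fun M : ℕ ↦ (Real.pi : ℂ) *
      Complex.cot (Real.pi * (z - ((-M - 1 : ℤ) : ℂ) * τ))) atTop (𝓝 (Real.pi * -Complex.I)) := by
    refine (tendsto_cot_pi_mul_neg_I ?_).const_mul _
    refine (tendsto_atTop_add_const_left _ (z.im + τ.im) hlim).congr fun M ↦ ?_
    simp; ring
  have h3 : Tendsto (fun M : ℕ ↦ (Real.pi : ℂ) *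
      Complex.cot (Real.pi * (z - ((M : ℤ) : ℂ) * τ))) atTop (𝓝 (Real.pi * Complex.I)) := by
    refine (tendsto_cot_pi_mul_I ?_).const_mul _
    refine (tendsto_atBot_add_const_left _ z.im (tendsto_neg_atTop_atBot.comp hlim)).congr
      fun M ↦ ?_
    simp; ring
  have h4 := tendsto_nhds_unique h1 ((h2.sub h3).congr fun M ↦ ?_)
  · have h5 := weierstrassZeta_add_one hτ z
    linear_combination h4 + τ * h5
  · rw [← sum_Icc_neg_telescope
      (fun m : ℤ ↦ (Real.pi : ℂ) * Complex.cot (Real.pi * (z - (m : ℂ) * τ)))]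
    refine Finset.sum_congr rfl fun m _ ↦ ?_
    rw [zetaRow_add_tau hτ m hz]
    ring

/-- The function `ζ z - 2 ζ(1/2) z`, which is `1`-periodic. -/
noncomputable def periodicZeta (τ z : ℂ) : ℂ :=
  weierstrassZeta (latticeOneTau τ) z - 2 * weierstrassZeta (latticeOneTau τ) (1 / 2) * z

lemma periodicZeta_add_one (hτ : 0 < τ.im) (z : ℂ) :
    periodicZeta τ (z + 1) = periodicZeta τ z := by
  rw [periodicZeta, weierstrassZeta_add_one hτ, periodicZeta]; ring

lemma periodicZeta_add_tau (hτ : 0 < τ.im) {z : ℂ} (hz : z ∉ latticeOneTau τ) :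
    periodicZeta τ (z + τ) = periodicZeta τ z - 2 * Real.pi * Complex.I := by
  rw [periodicZeta, weierstrassZeta_add_tau hτ hz, periodicZeta]; ring

lemma eventually_notMem_latticeOneTau (hτ : 0 < τ.im) (z : ℂ) :
    ∀ᶠ w in 𝓝[≠] z, w ∉ latticeOneTau τ := by
  have h := (oneTauPair hτ).compl_lattice_sdiff_singleton_mem_nhds z
  rw [eventually_nhdsWithin_iff]
  filter_upwards [h] with w hw hne hmem
  exact hw ⟨hmem, hne⟩

lemma analyticAt_weierstrassZeta (hτ : 0 < τ.im) {z : ℂ} (hz : z ∉ latticeOneTau τ) :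
    AnalyticAt ℂ (weierstrassZeta (latticeOneTau τ)) z := by
  have h0 : z ≠ 0 := by rintro rfl; exact hz (zero_mem _)
  have h1 : AnalyticAt ℂ (zetaReg (oneTauPair hτ)) z :=
    (differentiableOn_zetaReg (oneTauPair hτ)).analyticAt
      ((oneTauPair hτ).isOpen_compl_lattice_sdiff.mem_nhds fun h ↦ hz h.1)
  have h2 : weierstrassZeta (latticeOneTau τ) = fun z ↦ 1 / z + zetaReg (oneTauPair hτ) z :=
    funext (weierstrassZeta_eq_add_zetaReg (oneTauPair hτ))
  rw [h2]
  exact (analyticAt_const.div analyticAt_id h0).add h1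

lemma meromorphicAt_weierstrassZeta_zero (hτ : 0 < τ.im) :
    MeromorphicAt (weierstrassZeta (latticeOneTau τ)) 0 := by
  have h1 : AnalyticAt ℂ (zetaReg (oneTauPair hτ)) 0 :=
    (differentiableOn_zetaReg (oneTauPair hτ)).analyticAt
      ((oneTauPair hτ).isOpen_compl_lattice_sdiff.mem_nhds fun h ↦ h.2 rfl)
  have h2 : weierstrassZeta (latticeOneTau τ) = fun z ↦ 1 / z + zetaReg (oneTauPair hτ) z :=
    funext (weierstrassZeta_eq_add_zetaReg (oneTauPair hτ))
  rw [h2]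
  exact ((MeromorphicAt.const 1 0).div (MeromorphicAt.id 0)).add h1.meromorphicAt

/-- Quasi-periodicity carries the local behaviour at `0`, where the pole is explicit, to every
lattice point. -/
lemma meromorphicAt_periodicZeta_add (hτ : 0 < τ.im) {l : ℂ} (hl : l ∈ latticeOneTau τ)
    {z : ℂ} : MeromorphicAt (periodicZeta τ) (z + l) ↔ MeromorphicAt (periodicZeta τ) z := by
  induction hl using Submodule.span_induction generalizing z with
  | mem x hx =>
    rw [← meromorphicAt_comp_add_const_iff_meromorphicAt]
    rcases hx with rfl | rfl
    · simp only [Function.comp_def, periodicZeta_add_one hτ]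
    · rw [MeromorphicAt.meromorphicAt_congr
        (g := fun w ↦ periodicZeta x w - 2 * Real.pi * Complex.I)]
      · exact MeromorphicAt.meromorphicAt_fun_sub_iff_meromorphicAt₂ (.const _ _)
      · filter_upwards [eventually_notMem_latticeOneTau hτ z] with w hw
        exact periodicZeta_add_tau hτ hw
  | zero => simp
  | add x y _ _ hx hy => rw [← add_assoc, hy, hx]
  | smul a x _ hx =>
    induction a with
    | zero => simp
    | succ n ih => rw [add_smul, one_smul, ← add_assoc, hx, ih]
    | pred n ih => rw [← hx, sub_smul, one_smul, add_assoc, sub_add_cancel, ih]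

lemma meromorphicAt_periodicZeta (hτ : 0 < τ.im) (z : ℂ) : MeromorphicAt (periodicZeta τ) z := by
  have hlin : ∀ w, MeromorphicAt
      (fun z ↦ 2 * weierstrassZeta (latticeOneTau τ) (1 / 2) * z) w :=
    fun w ↦ (MeromorphicAt.const _ w).mul (MeromorphicAt.id w)
  by_cases hz : z ∈ latticeOneTau τ
  · rw [← zero_add z, meromorphicAt_periodicZeta_add hτ hz]
    exact (meromorphicAt_weierstrassZeta_zero hτ).sub (hlin 0)
  · exact (analyticAt_weierstrassZeta hτ hz).meromorphicAt.sub (hlin z)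

lemma continuousAt_periodicZeta (hτ : 0 < τ.im) {z : ℂ} (hz : z ∉ latticeOneTau τ) :
    ContinuousAt (periodicZeta τ) z :=
  (analyticAt_weierstrassZeta hτ hz).continuousAt.sub (by fun_prop)

end QuasiPeriods

/-! ### Translation on the Riemann sphere -/

section AddFin

@[simp] lemma addFin_infty (c : ℂ) : addFin OnePoint.infty c = OnePoint.infty := rfl

@[simp] lemma addFin_coe (x c : ℂ) : addFin (x : OnePoint ℂ) c = ((x + c : ℂ) : OnePoint ℂ) := rfl

@[simp] lemma addFin_zero (p : OnePoint ℂ) : addFin p 0 = p := by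
  induction p using OnePoint.rec <;> simp

lemma addFin_addFin (p : OnePoint ℂ) (c d : ℂ) : addFin (addFin p c) d = addFin p (c + d) := by
  induction p using OnePoint.rec <;> simp [add_assoc]

/-- At `∞` the point is `‖x + c‖ ≥ ‖x‖ - ‖c‖` with `c` locally bounded. Joint continuity lets
identities proved off a small set extend across poles. -/
lemma continuous_addFin : Continuous fun q : OnePoint ℂ × ℂ ↦ addFin q.1 q.2 := by
  rw [continuous_iff_continuousAt]
  rintro ⟨p, c⟩
  rw [ContinuousAt, nhds_prod_eq]
  induction p using OnePoint.rec with
  | coe x =>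
    rw [OnePoint.nhds_coe_eq, ← Filter.map_id (f := 𝓝 c), Filter.prod_map_map_eq, tendsto_map'_iff,
      ← nhds_prod_eq]
    have : Tendsto (fun q : ℂ × ℂ ↦ ((q.1 + q.2 : ℂ) : OnePoint ℂ)) (𝓝 (x, c))
        (𝓝 ((x + c : ℂ) : OnePoint ℂ)) :=
      (OnePoint.continuous_coe.comp continuous_add).tendsto _
    exact this
  | infty =>
    rw [OnePoint.nhds_infty_eq, Filter.sup_prod, tendsto_sup]
    constructor
    · rw [← Filter.map_id (f := 𝓝 c), Filter.prod_map_map_eq, tendsto_map'_iff,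
        coclosedCompact_eq_cocompact, ← Metric.cobounded_eq_cocompact]
      have h : Tendsto (fun q : ℂ × ℂ ↦ q.1 + q.2) (Bornology.cobounded ℂ ×ˢ 𝓝 c)
          (Bornology.cobounded ℂ) := by
        rw [← tendsto_norm_atTop_iff_cobounded]
        have h1 : Tendsto (fun q : ℂ × ℂ ↦ ‖q.1‖) (Bornology.cobounded ℂ ×ˢ 𝓝 c) atTop :=
          tendsto_norm_cobounded_atTop.comp tendsto_fst
        have h2 : Tendsto (fun q : ℂ × ℂ ↦ -‖q.2‖) (Bornology.cobounded ℂ ×ˢ 𝓝 c) (𝓝 (-‖c‖)) :=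
          (tendsto_snd (f := Bornology.cobounded ℂ) (g := 𝓝 c)).norm.neg
        refine tendsto_atTop_mono (fun q ↦ ?_) (h1.atTop_add h2)
        have := norm_sub_norm_le q.1 (-q.2)
        rw [norm_neg, sub_neg_eq_add] at this
        linarith
      rw [Metric.cobounded_eq_cocompact, ← coclosedCompact_eq_cocompact] at h ⊢
      exact OnePoint.tendsto_coe_infty.comp h
    · refine Tendsto.congr' ?_ tendsto_const_nhds
      rw [EventuallyEq, Filter.eventually_prod_iff]
      exact ⟨fun p ↦ p = OnePoint.infty, by simp, fun _ ↦ True, by simp, by rintro _ rfl _ _; rfl⟩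

lemma ContinuousAt.addFin {X : Type*} [TopologicalSpace X] {p : X → OnePoint ℂ} {a : X → ℂ} {x : X}
    (hp : ContinuousAt p x) (ha : ContinuousAt a x) :
    ContinuousAt (fun y ↦ addFin (p y) (a y)) x :=
  continuous_addFin.continuousAt.comp (f := fun y ↦ (p y, a y)) (hp.prodMk ha)

lemma exists_coe_of_ne_infty {p : OnePoint ℂ} (h : p ≠ OnePoint.infty) : ∃ c : ℂ, p = c := by
  obtain ⟨c, hc⟩ := OnePoint.ne_infty_iff_exists.mp h
  exact ⟨c, hc.symm⟩

end AddFin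

/-! ### Sphere-valued meromorphic functions -/

section Meromorphic

variable {f g : ℂ → OnePoint ℂ} {z : ℂ}

lemma IsMeromorphicAt.addFin (hf : IsMeromorphicAt f z) {a : ℂ → ℂ} (ha : MeromorphicAt a z)
    (hc : ContinuousAt a z) : IsMeromorphicAt (fun w ↦ addFin (f w) (a w)) z := by
  obtain ⟨⟨h, hh, he⟩, hfc⟩ := hf
  refine ⟨⟨fun w ↦ h w + a w, hh.add ha, ?_⟩, ContinuousAt.addFin hfc hc⟩
  filter_upwards [he] with w hw
  rw [hw, addFin_coe]

lemma IsMeromorphicAt.comp_analyticAt {u : ℂ → ℂ} (hf : IsMeromorphicAt f (u z))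
    (hu : AnalyticAt ℂ u z) (hne : ∀ᶠ w in 𝓝[≠] z, u w ≠ u z) :
    IsMeromorphicAt (f ∘ u) z := by
  obtain ⟨⟨h, hh, he⟩, hfc⟩ := hf
  refine ⟨⟨h ∘ u, hh.comp_analyticAt hu, ?_⟩, hfc.comp hu.continuousAt⟩
  have : Tendsto u (𝓝[≠] z) (𝓝[≠] (u z)) :=
    tendsto_nhdsWithin_iff.mpr ⟨hu.continuousAt.tendsto.mono_left nhdsWithin_le_nhds, hne⟩
  exact this.eventually he

lemma IsMeromorphicOn.continuous (hf : IsMeromorphicOn f Set.univ) : Continuous f :=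
  continuous_iff_continuousAt.mpr fun z ↦ (hf z trivial).2

lemma IsMeromorphicAt.eventually_ne_infty (hf : IsMeromorphicAt f z) :
    ∀ᶠ w in 𝓝[≠] z, f w ≠ OnePoint.infty := by
  obtain ⟨⟨h, -, he⟩, -⟩ := hf
  filter_upwards [he] with w hw
  rw [hw]; exact OnePoint.coe_ne_infty _

lemma eq_of_continuousAt_of_eventuallyEq (hf : ContinuousAt f z) (hg : ContinuousAt g z)
    (h : f =ᶠ[𝓝[≠] z] g) : f z = g z :=
  tendsto_nhds_unique (hf.tendsto.mono_left nhdsWithin_le_nhds)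
    ((hg.tendsto.mono_left nhdsWithin_le_nhds).congr' h.symm)

lemma IsMeromorphicOn.countable_poles (hf : IsMeromorphicOn f Set.univ) :
    {z | f z = OnePoint.infty}.Countable := by
  have hd : DiscreteTopology {z | f z = OnePoint.infty} := by
    rw [discreteTopology_subtype_iff]
    intro z _
    rw [← Filter.empty_mem_iff_bot]
    filter_upwards [mem_inf_of_left (hf z trivial).eventually_ne_infty,
      mem_inf_of_right (mem_principal_self _)] with w h1 h2
    exact h1 h2
  exact Set.countable_coe_iff.mp
    (countable_of_Lindelof_of_discrete (X := {z | f z = OnePoint.infty}))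

lemma exists_tendsto_coe_of_meromorphicAt {h : ℂ → ℂ} (hh : MeromorphicAt h z) :
    ∃ p : OnePoint ℂ, Tendsto (fun w ↦ (h w : OnePoint ℂ)) (𝓝[≠] z) (𝓝 p) := by
  rcases lt_or_ge (meromorphicOrderAt h z) 0 with ho | ho
  · refine ⟨OnePoint.infty, OnePoint.tendsto_coe_infty.comp ?_⟩
    rw [coclosedCompact_eq_cocompact, ← Metric.cobounded_eq_cocompact]
    exact tendsto_cobounded_of_meromorphicOrderAt_neg ho
  · obtain ⟨c, hc⟩ := tendsto_nhds_of_meromorphicOrderAt_nonneg hh ho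
    exact ⟨c, (OnePoint.continuous_coe.tendsto c).comp hc⟩

/-- A function on `ℂ` that is locally finite and meromorphic off a discrete set extends to a
meromorphic function into the Riemann sphere, which agrees with it where it is continuous. -/
lemma exists_isMeromorphicOn_extension
    (hf : ∀ z, ∃ h : ℂ → ℂ, MeromorphicAt h z ∧ ∀ᶠ w in 𝓝[≠] z, f w = (h w : OnePoint ℂ))
    (hc : ∀ z, ∀ᶠ w in 𝓝[≠] z, ContinuousAt f w) :
    ∃ E : ℂ → OnePoint ℂ, IsMeromorphicOn E Set.univ ∧ ∀ z, ContinuousAt f z → E z = f z := by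
  have hlim : ∀ z, ∃ p : OnePoint ℂ, Tendsto f (𝓝[≠] z) (𝓝 p) := fun z ↦ by
    obtain ⟨h, hh, he⟩ := hf z
    obtain ⟨p, hp⟩ := exists_tendsto_coe_of_meromorphicAt hh
    exact ⟨p, hp.congr' (he.mono fun w hw ↦ hw.symm)⟩
  choose E hE using hlim
  have hEf : ∀ z, ContinuousAt f z → E z = f z := fun z hz ↦
    tendsto_nhds_unique (hE z) (hz.tendsto.mono_left nhdsWithin_le_nhds)
  have hev : ∀ z, E =ᶠ[𝓝[≠] z] f := fun z ↦ (hc z).mono hEf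
  refine ⟨E, fun z _ ↦ ⟨?_, ?_⟩, hEf⟩
  · obtain ⟨h, hh, he⟩ := hf z
    exact ⟨h, hh, (hev z).trans he⟩
  · rw [continuousAt_iff_punctured_nhds]
    exact (hE z).congr' (hev z).symm

end Meromorphic

/-! ### Fibres and local inverses of the exponential -/

section ExpPer

lemma expPer_ne_zero (τ z : ℂ) : expPer τ z ≠ 0 := Complex.exp_ne_zero _

lemma expPer_eq_iff {τ : ℂ} (hτ : τ ≠ 0) {z w : ℂ} :
    expPer τ z = expPer τ w ↔ ∃ n : ℤ, z = w + n * τ := by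
  have h2 := Complex.two_pi_I_ne_zero
  rw [expPer, expPer, Complex.exp_eq_exp_iff_exists_int]
  refine exists_congr fun n ↦ ?_
  rw [div_eq_iff hτ, add_mul, div_mul_cancel₀ _ hτ,
    show 2 * (Real.pi : ℂ) * Complex.I * w + n * (2 * Real.pi * Complex.I) * τ =
      2 * Real.pi * Complex.I * (w + n * τ) by ring]
  exact mul_right_inj' h2

lemma expPer_one (z : ℂ) : expPer 1 z = Complex.exp (2 * Real.pi * Complex.I * z) := by
  simp [expPer]

lemma exists_expPer_one_eq {w : ℂ} (hw : w ≠ 0) : ∃ z, expPer 1 z = w := by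
  refine ⟨Complex.log w / (2 * Real.pi * Complex.I), ?_⟩
  rw [expPer_one, mul_div_cancel₀ _ Complex.two_pi_I_ne_zero, Complex.exp_log hw]

lemma analyticAt_expPer_one (z : ℂ) : AnalyticAt ℂ (expPer 1) z := by
  have : expPer 1 = fun z ↦ Complex.exp (2 * Real.pi * Complex.I * z) := funext expPer_one
  rw [this]; fun_prop

/-- Near each `w ≠ 0`, the map `expPer 1` has an analytic local inverse with a prescribed value. -/
lemma exists_local_inverse_expPer_one (z : ℂ) :
    ∃ u : ℂ → ℂ, AnalyticAt ℂ u (expPer 1 z) ∧ u (expPer 1 z) = z ∧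
      (∀ᶠ w in 𝓝 (expPer 1 z), expPer 1 (u w) = w) := by
  have h0 := expPer_ne_zero 1 z
  have h2 := Complex.two_pi_I_ne_zero
  refine ⟨fun w ↦ z + Complex.log (w / expPer 1 z) / (2 * Real.pi * Complex.I), ?_, ?_, ?_⟩
  · refine analyticAt_const.add (AnalyticAt.div ?_ analyticAt_const h2)
    exact (analyticAt_id.div analyticAt_const h0).clog (by simp [h0])
  · simp [h0]
  · filter_upwards [isOpen_ne.mem_nhds h0] with w hw
    have : expPer 1 (z + Complex.log (w / expPer 1 z) / (2 * Real.pi * Complex.I)) =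
        expPer 1 z * Complex.exp (Complex.log (w / expPer 1 z)) := by
      rw [expPer_one, expPer_one, mul_add, Complex.exp_add, mul_div_cancel₀ _ h2]
    rw [this, Complex.exp_log (div_ne_zero hw h0), mul_div_cancel₀ _ h0]

end ExpPer

/-! ### Algebra of pseudoperiods -/

section Pseudoperiods

variable {f : ℂ → OnePoint ℂ} {τ τ' η η' : ℂ}

lemma HasPseudoperiod.zero : HasPseudoperiod f 0 0 := fun z ↦ by simp

lemma HasPseudoperiod.add (h : HasPseudoperiod f τ η) (h' : HasPseudoperiod f τ' η') :
    HasPseudoperiod f (τ + τ') (η + η') := fun z ↦ by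
  rw [← add_assoc, h', h, addFin_addFin]

lemma HasPseudoperiod.neg (h : HasPseudoperiod f τ η) : HasPseudoperiod f (-τ) (-η) := fun z ↦ by
  have := h (z + -τ)
  rw [neg_add_cancel_right] at this
  rw [this, addFin_addFin, add_neg_cancel, addFin_zero]

lemma HasPseudoperiod.intCast_mul (h : HasPseudoperiod f τ η) (n : ℤ) :
    HasPseudoperiod f (n * τ) (n * η) := by
  induction n with
  | zero => simpa using HasPseudoperiod.zero
  | succ n ih => simpa [add_mul] using ih.add h
  | pred n ih => simpa [add_mul, sub_eq_add_neg] using ih.add h.neg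

lemma isPseudoperiodicWrt_span {S : Set ℂ} (hf : IsMeromorphicOn f Set.univ)
    (hS : ∀ τ ∈ S, ∃ η, HasPseudoperiod f τ η) :
    IsPseudoperiodicWrt f (Submodule.span ℤ S) := by
  refine ⟨hf, fun τ hτ ↦ ?_⟩
  induction hτ using Submodule.span_induction with
  | mem x hx => exact hS x hx
  | zero => exact ⟨0, .zero⟩
  | add x y _ _ hx hy =>
    obtain ⟨a, ha⟩ := hx
    obtain ⟨b, hb⟩ := hy
    exact ⟨a + b, ha.add hb⟩
  | smul n x _ hx =>
    obtain ⟨a, ha⟩ := hx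
    exact ⟨n * a, by simpa using ha.intCast_mul n⟩

lemma IsMeromorphicOn.exists_ne_infty (hf : IsMeromorphicOn f Set.univ) :
    ∃ z, f z ≠ OnePoint.infty :=
  (hf 0 trivial).eventually_ne_infty.exists

lemma HasPseudoperiod.unique (hf : IsMeromorphicOn f Set.univ) (h : HasPseudoperiod f τ η)
    (h' : HasPseudoperiod f τ η') : η = η' := by
  obtain ⟨z, hz⟩ := hf.exists_ne_infty
  obtain ⟨c, hc⟩ := exists_coe_of_ne_infty hz
  have := (h z).symm.trans (h' z)
  simpa [hc] using this

lemma HasPseudoperiod.eq_add (h : HasPseudoperiod f τ η) {z c d : ℂ} (hc : f z = c) {n : ℤ}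
    (hd : f (z + n * τ) = d) : d = c + n * η := by
  have := h.intCast_mul n z
  rw [hd, hc, addFin_coe] at this
  exact OnePoint.coe_injective this

end Pseudoperiods

/-! ### Projectability and integer pseudoperiods -/

section Projectable

variable {f : ℂ → OnePoint ℂ}

lemma IsAffine.isRational (h : IsAffine f) : IsRational f := by
  obtain ⟨a, b, h⟩ := h
  refine ⟨Polynomial.C a * Polynomial.X + Polynomial.C b, 1, one_ne_zero, fun z _ ↦ ?_⟩
  simp [h]

/-- Along the integers beyond the roots of `Q` the values of `P / Q` form an arithmetic progression.
Hence `P` equals a linear polynomial times `Q` at infinitely many points, so identically. -/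
lemma IsRational.isAffine_of_hasPseudoperiod (hr : IsRational f)
    (hf : IsMeromorphicOn f Set.univ) {ℓ : ℂ} (h : HasPseudoperiod f 1 ℓ) : IsAffine f := by
  obtain ⟨P, Q, hQ, hPQ⟩ := hr
  have hroots : {z | Q.eval z = 0}.Finite := by
    simpa [Polynomial.IsRoot] using Polynomial.finite_setOfPred_isRoot hQ
  obtain ⟨N, hN⟩ : ∃ N : ℕ, ∀ n : ℕ, N ≤ n → Q.eval (n : ℂ) ≠ 0 := by
    have h1 : Tendsto (Nat.cast : ℕ → ℂ) cofinite cofinite := Nat.cast_injective.tendsto_cofinite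
    rw [Nat.cofinite_eq_atTop] at h1
    exact eventually_atTop.mp (h1.eventually hroots.eventually_cofinite_notMem)
  set c : ℂ := P.eval (N : ℂ) / Q.eval (N : ℂ) with hc
  have hval : ∀ n : ℕ, P.eval ((N + n : ℕ) : ℂ) =
      (c + ℓ * n) * Q.eval ((N + n : ℕ) : ℂ) := fun n ↦ by
    have hd : f ((N : ℂ) + (n : ℤ) * 1) =
        ((P.eval ((N + n : ℕ) : ℂ) / Q.eval ((N + n : ℕ) : ℂ) : ℂ) : OnePoint ℂ) := by
      rw [← hPQ _ (hN _ (Nat.le_add_right N n))]; simp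
    have := h.eq_add (hPQ _ (hN N le_rfl)) hd
    rw [div_eq_iff (hN _ (Nat.le_add_right N n))] at this
    rw [this]; push_cast; ring
  have hpoly : P = (Polynomial.C ℓ * Polynomial.X + Polynomial.C (c - ℓ * N)) * Q := by
    refine Polynomial.eq_of_infinite_eval_eq _ _ (Set.infinite_of_injective_forall_mem
      (f := fun n : ℕ ↦ ((N + n : ℕ) : ℂ)) (fun a b hab ↦ ?_) fun n ↦ ?_)
    · simpa using hab
    · simp only [Set.mem_ofPred_eq, hval n, Polynomial.eval_mul, Polynomial.eval_add,
        Polynomial.eval_C, Polynomial.eval_X]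
      push_cast
      ring
  refine ⟨ℓ, c - ℓ * N, fun z ↦ ?_⟩
  refine congrFun (Continuous.ext_on (s := {z | Q.eval z = 0}ᶜ)
    (hroots.countable.dense_compl ℝ) hf.continuous
    (OnePoint.continuous_coe.comp (by fun_prop : Continuous fun z ↦ ℓ * z + (c - ℓ * N)))
    fun z hz ↦ ?_) z
  have hz' : Q.eval z ≠ 0 := hz
  rw [hPQ z hz', hpoly]
  simp [hz']

lemma IsProjectable.exists_hasPseudoperiod_one (h : IsProjectable 1 f) :
    ∃ ℓ : ℤ, HasPseudoperiod f 1 (ℓ : ℂ) := by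
  obtain ⟨⟨hf, -⟩, g, hg⟩ := h
  have hcont := hf.continuous
  -- Off `T` both `f z` and `f (z + 1)` are finite, so their integer difference is a continuous
  -- function on a connected set.
  set T : Set ℂ := {z | f z = OnePoint.infty} ∪ {z | f (z + 1) = OnePoint.infty} with hT
  have hTc : T.Countable := hf.countable_poles.union
    (hf.countable_poles.preimage (add_left_injective (1 : ℂ)))
  have hconn := (hTc.isConnected_compl_of_one_lt_rank (by simp)).isPreconnected
  have h0 : ∀ z : ↥Tᶜ, ∃ c : ℂ, f z = c := fun z ↦ exists_coe_of_ne_infty fun h ↦ z.2 (.inl h)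
  have h1 : ∀ z : ↥Tᶜ, ∃ c : ℂ, f (z + 1) = c := fun z ↦
    exists_coe_of_ne_infty fun h ↦ z.2 (.inr h)
  choose c hc using h0
  choose d hd using h1
  have hk : ∀ z : ↥Tᶜ, ∃ k : ℤ, d z = c z + k := fun z ↦ by
    have e : expPer 1 (z + 1 : ℂ) = expPer 1 z := (expPer_eq_iff one_ne_zero).mpr ⟨1, by simp⟩
    have := (hg _ _ (hd z)).symm.trans (e ▸ hg _ _ (hc z))
    simpa using (expPer_eq_iff one_ne_zero).mp this
  choose k hk using hk
  have hcc : Continuous c := OnePoint.isOpenEmbedding_coe.isEmbedding.continuous_iff.mpr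
    ((hcont.comp continuous_subtype_val).congr hc)
  have hdc : Continuous d := OnePoint.isOpenEmbedding_coe.isEmbedding.continuous_iff.mpr
    ((hcont.comp (continuous_subtype_val.add continuous_const)).congr hd)
  have hkc : Continuous k := Complex.isClosedEmbedding_intCast.isEmbedding.continuous_iff.mpr
    ((hdc.sub hcc).congr fun z ↦ by simp [hk z])
  have : PreconnectedSpace ↥Tᶜ := isPreconnected_iff_preconnectedSpace.mp hconn
  have hdense : Dense Tᶜ := hTc.dense_compl ℝ
  obtain ⟨z₀, hz₀⟩ := hdense.nonempty
  refine ⟨k ⟨z₀, hz₀⟩, fun z ↦ ?_⟩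
  refine congrFun (Continuous.ext_on (f := fun z ↦ f (z + 1)) hdense (by fun_prop)
    (continuous_addFin.comp (hcont.prodMk continuous_const)) fun w hw ↦ ?_) z
  have hw' : k ⟨w, hw⟩ = k ⟨z₀, hz₀⟩ := PreconnectedSpace.constant inferInstance hkc
  simp only [Function.comp]
  rw [hd ⟨w, hw⟩, hk ⟨w, hw⟩, hc ⟨w, hw⟩, addFin_coe, hw']

lemma isProjectable_of_hasPseudoperiod {τ : ℂ} (hτ : τ ≠ 0) (hf : IsTranscendentalMeromorphic f)
    {ℓ : ℤ} (h : HasPseudoperiod f τ (ℓ * τ)) : IsProjectable τ f := by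
  classical
  -- The value comes from any finite point of the fibre over `w`: two such points differ by `n τ`,
  -- their values by `n ℓ τ`, which `expPer τ` ignores.
  refine ⟨hf, fun w ↦ if hw : ∃ z c : ℂ, f z = (c : OnePoint ℂ) ∧ expPer τ z = w then
    expPer τ hw.choose_spec.choose else 0, fun z c hc ↦ ?_⟩
  have hw : ∃ z' c' : ℂ, f z' = (c' : OnePoint ℂ) ∧ expPer τ z' = expPer τ z := ⟨z, c, hc, rfl⟩
  obtain ⟨h1, h2⟩ := hw.choose_spec.choose_spec
  refine (dif_pos hw).trans ?_
  obtain ⟨n, hn⟩ := (expPer_eq_iff hτ).mp h2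
  have h3 := h.eq_add hc ((congrArg f hn).symm.trans h1)
  exact (expPer_eq_iff hτ).mpr ⟨n * ℓ, by rw [h3]; push_cast; ring⟩

theorem isProjectable_one_iff :
    IsProjectable 1 f ↔ IsPseudoperiodic f ∧ ¬ IsAffine f ∧
      ∃ ℓ : ℤ, HasPseudoperiod f 1 (ℓ : ℂ) := by
  constructor
  · intro h
    obtain ⟨ℓ, hℓ⟩ := h.exists_hasPseudoperiod_one
    refine ⟨⟨Submodule.span ℤ {1}, .inl ⟨1, one_ne_zero, rfl⟩,
      isPseudoperiodicWrt_span h.1.1 ?_⟩, fun ha ↦ h.1.2 ha.isRational, ℓ, hℓ⟩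
    rintro _ rfl
    exact ⟨ℓ, hℓ⟩
  · rintro ⟨⟨Λ, -, hf, -⟩, ha, ℓ, hℓ⟩
    exact isProjectable_of_hasPseudoperiod one_ne_zero
      ⟨hf, fun hr ↦ ha (hr.isAffine_of_hasPseudoperiod hf hℓ)⟩ (ℓ := ℓ) (by simpa using hℓ)

end Projectable

/-! ### Descent to the punctured plane -/

section Form

variable {f : ℂ → OnePoint ℂ} {ℓ : ℤ} {Φ : ℂ → OnePoint ℂ}

lemma IsMeromorphicAt.congr {g h : ℂ → OnePoint ℂ} {z : ℂ} (hg : IsMeromorphicAt g z)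
    (hgh : g =ᶠ[𝓝 z] h) : IsMeromorphicAt h z := by
  obtain ⟨⟨k, hk, he⟩, hc⟩ := hg
  refine ⟨⟨k, hk, ?_⟩, hc.congr hgh⟩
  filter_upwards [he, hgh.filter_mono nhdsWithin_le_nhds] with w h1 h2
  rw [← h2, h1]

lemma HasForm.apply_expPer (h : HasForm f ℓ Φ) (z : ℂ) :
    Φ (expPer 1 z) = addFin (f z) (-(ℓ * z)) := by
  rw [h.2.2 z, addFin_addFin, add_neg_cancel, addFin_zero]

lemma HasForm.hasPseudoperiod_one (h : HasForm f ℓ Φ) : HasPseudoperiod f 1 ℓ := fun z ↦ by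
  have e : expPer 1 (z + 1) = expPer 1 z := (expPer_eq_iff one_ne_zero).mpr ⟨1, by simp⟩
  rw [h.2.2, h.2.2 z, e, addFin_addFin, mul_add, mul_one]

lemma exists_hasForm (hf : IsMeromorphicOn f Set.univ) (ha : ¬ IsAffine f)
    (h : HasPseudoperiod f 1 ℓ) : ∃ Φ, HasForm f ℓ Φ := by
  choose! s hs using fun w (hw : w ≠ 0) ↦ exists_expPer_one_eq hw
  -- The value at `w` is independent of the chosen logarithm `s w`, which need not be continuous;
  -- this allows an analytic branch to replace it locally.
  have hG : ∀ z, addFin (f (s (expPer 1 z))) (-(ℓ * s (expPer 1 z))) =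
      addFin (f z) (-(ℓ * z)) := fun z ↦ by
    obtain ⟨n, hn⟩ := (expPer_eq_iff one_ne_zero).mp (hs _ (expPer_ne_zero 1 z))
    rw [hn, h.intCast_mul n z, addFin_addFin]
    congr 1
    ring
  refine ⟨fun w ↦ addFin (f (s w)) (-(ℓ * s w)), fun w hw ↦ ?_, ?_, fun z ↦ ?_⟩
  · obtain ⟨z, rfl⟩ := exists_expPer_one_eq hw
    obtain ⟨u, hu, huz, hinv⟩ := exists_local_inverse_expPer_one z
    have hGm : IsMeromorphicAt (fun z ↦ addFin (f z) (-(ℓ * z))) (u (expPer 1 z)) := by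
      have ha : AnalyticAt ℂ (fun z : ℂ ↦ -(ℓ * z)) (u (expPer 1 z)) := by fun_prop
      exact (hf _ trivial).addFin ha.meromorphicAt ha.continuousAt
    refine (hGm.comp_analyticAt hu ?_).congr ?_
    · filter_upwards [hinv.filter_mono nhdsWithin_le_nhds, self_mem_nhdsWithin] with w h1 h2 h3
      rw [h3, huz] at h1
      exact h2 h1.symm
    · filter_upwards [hinv] with w hw
      rw [Function.comp, ← hG, hw]
  · rintro ⟨c, hc⟩
    have hc' : ∀ z, f z = addFin c (ℓ * z) := fun z ↦ by
      rw [← hc _ (expPer_ne_zero 1 z)]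
      beta_reduce
      rw [hG, addFin_addFin, neg_add_cancel, addFin_zero]
    induction c using OnePoint.rec with
    | infty =>
      obtain ⟨z, hz⟩ := hf.exists_ne_infty
      exact hz (hc' z)
    | coe b => exact ha ⟨ℓ, b, fun z ↦ by rw [hc', addFin_coe, add_comm]⟩
  · beta_reduce
    rw [hG, addFin_addFin, neg_add_cancel, addFin_zero]

lemma HasForm.unique (hf : IsMeromorphicOn f Set.univ) (h : HasForm f ℓ Φ) {ℓ' : ℤ}
    {Φ' : ℂ → OnePoint ℂ} (h' : HasForm f ℓ' Φ') : ℓ' = ℓ ∧ Set.EqOn Φ' Φ {0}ᶜ := by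
  have hℓ : ℓ' = ℓ := by
    exact_mod_cast h'.hasPseudoperiod_one.unique hf h.hasPseudoperiod_one
  refine ⟨hℓ, fun w hw ↦ ?_⟩
  obtain ⟨z, rfl⟩ := exists_expPer_one_eq hw
  rw [h.apply_expPer, h'.apply_expPer, hℓ]

end Form

/-! ### The elliptic remainder -/

section DoublyPseudoperiodic

variable {f : ℂ → OnePoint ℂ} {ℓ : ℤ} {Φ : ℂ → OnePoint ℂ} {τ η : ℂ}

lemma HasForm.hasPseudoperiod_of_hasDoublyForm (hf : IsMeromorphicOn f Set.univ)
    (h : HasForm f ℓ Φ) (hτ : 0 < τ.im) (hd : HasDoublyForm ℓ Φ τ η) :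
    HasPseudoperiod f τ η := by
  obtain ⟨E, -, -, hEτ, hE⟩ := hd
  have key : ∀ z, z ∉ latticeOneTau τ → f (z + τ) = addFin (f z) η := fun z hz ↦ by
    have hz' : z + τ ∉ latticeOneTau τ := fun hm ↦
      hz (by simpa using sub_mem hm (tau_mem_latticeOneTau (τ := τ)))
    have hper := periodicZeta_add_tau hτ hz
    rw [h.2.2, h.2.2 z, hE z hz, hE _ hz', hEτ, addFin_addFin, addFin_addFin, addFin_addFin]
    congr 1
    change _ * periodicZeta τ (z + τ) + _ = _ * periodicZeta τ z + (_ + _)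
    rw [hper]
    have := Complex.two_pi_I_ne_zero
    field_simp
    ring
  intro z
  refine eq_of_continuousAt_of_eventuallyEq (f := fun z ↦ f (z + τ))
    (g := fun z ↦ addFin (f z) η) (hf.continuous.comp (continuous_add_const τ)).continuousAt
    (ContinuousAt.addFin hf.continuous.continuousAt continuousAt_const) ?_
  exact (eventually_notMem_latticeOneTau hτ z).mono key

lemma HasForm.hasDoublyForm_of_hasPseudoperiod (hf : IsMeromorphicOn f Set.univ)
    (h : HasForm f ℓ Φ) (hτ : 0 < τ.im) (hη : HasPseudoperiod f τ η) :
    HasDoublyForm ℓ Φ τ η := by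
  set C : ℂ := (ℓ * τ - η) / (2 * Real.pi * Complex.I) with hC
  -- This is the candidate for `E`. At lattice points it carries arbitrary values, since
  -- `periodicZeta` does, so its meromorphic extension is used instead and the periods pass over by
  -- continuity.
  set F : ℂ → OnePoint ℂ := fun z ↦ addFin (f z) (-(ℓ * z) - C * periodicZeta τ z) with hF
  have hFc : ∀ z, z ∉ latticeOneTau τ → ContinuousAt F z := fun z hz ↦
    ContinuousAt.addFin hf.continuous.continuousAt
      (ContinuousAt.sub (by fun_prop) ((continuousAt_periodicZeta hτ hz).const_mul C))
  have hFone : ∀ z, F (z + 1) = F z := fun z ↦ by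
    simp only [hF]
    rw [h.hasPseudoperiod_one z, addFin_addFin, periodicZeta_add_one hτ]
    congr 1; ring
  have hFtau : ∀ z, z ∉ latticeOneTau τ → F (z + τ) = F z := fun z hz ↦ by
    simp only [hF]
    rw [hη z, addFin_addFin, periodicZeta_add_tau hτ hz, hC]
    congr 1
    have := Complex.two_pi_I_ne_zero
    field_simp
    ring
  obtain ⟨E, hE, hEF⟩ := exists_isMeromorphicOn_extension (f := F) (fun z ↦ by
      obtain ⟨⟨k, hk, he⟩, -⟩ := hf z trivial
      have ha : MeromorphicAt (fun z ↦ -(ℓ * z) - C * periodicZeta τ z) z :=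
        (by fun_prop : AnalyticAt ℂ (fun z : ℂ ↦ -(ℓ * z)) z).meromorphicAt.sub
          ((MeromorphicAt.const C z).mul (meromorphicAt_periodicZeta hτ z))
      refine ⟨_, hk.add ha, ?_⟩
      filter_upwards [he] with w hw
      simp only [hF, hw, addFin_coe, Pi.add_apply])
    fun z ↦ (eventually_notMem_latticeOneTau hτ z).mono hFc
  have hper : ∀ t ∈ latticeOneTau τ, (∀ z, z ∉ latticeOneTau τ → F (z + t) = F z) →
      Function.Periodic E t := fun t ht hFt z ↦ by
    refine eq_of_continuousAt_of_eventuallyEq (f := fun z ↦ E (z + t))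
      (hE.continuous.comp (continuous_add_const t)).continuousAt hE.continuous.continuousAt ?_
    filter_upwards [eventually_notMem_latticeOneTau hτ z] with w hw
    have hw' : w + t ∉ latticeOneTau τ := fun hm ↦ hw (by simpa using sub_mem hm ht)
    rw [hEF _ (hFc _ hw), hEF _ (hFc _ hw'), hFt w hw]
  refine ⟨E, hE, hper 1 one_mem_latticeOneTau fun z _ ↦ hFone z,
    hper τ tau_mem_latticeOneTau hFtau, fun z hz ↦ ?_⟩
  change _ = addFin (E z) (C * periodicZeta τ z)
  rw [hEF z (hFc z hz), h.apply_expPer, addFin_addFin]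
  congr 1; ring

lemma HasForm.hasPseudoperiod_iff (hf : IsMeromorphicOn f Set.univ) (h : HasForm f ℓ Φ)
    (hτ : 0 < τ.im) : HasPseudoperiod f τ η ↔ HasDoublyForm ℓ Φ τ η :=
  ⟨h.hasDoublyForm_of_hasPseudoperiod hf hτ, h.hasPseudoperiod_of_hasDoublyForm hf hτ⟩

/-- Two generators with non-real ratio cannot both be real, and a sign change puts a non-real one in
the upper half plane. -/
lemma IsDoublyPseudoperiodic.exists_hasPseudoperiod (h : IsDoublyPseudoperiodic f) :
    ∃ τ : ℂ, 0 < τ.im ∧ ∃ η, HasPseudoperiod f τ η := by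
  obtain ⟨τ₁, τ₂, him, -, hper⟩ := h
  have main : ∀ τ ∈ Submodule.span ℤ {τ₁, τ₂}, τ.im ≠ 0 →
      ∃ τ : ℂ, 0 < τ.im ∧ ∃ η, HasPseudoperiod f τ η := fun τ hτ hne ↦ by
    rcases hne.lt_or_gt with hlt | hgt
    · exact ⟨-τ, by simpa using hlt, hper _ (neg_mem hτ)⟩
    · exact ⟨τ, hgt, hper _ hτ⟩
  by_cases h1 : τ₁.im = 0
  · refine main τ₂ (Submodule.subset_span (by simp)) fun h2 ↦ ?_
    simp [Complex.div_im, h1, h2] at him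
  · exact main τ₁ (Submodule.subset_span (by simp)) h1

lemma isDoublyPseudoperiodic_of_hasPseudoperiod (hf : IsMeromorphicOn f Set.univ)
    (h : HasPseudoperiod f 1 ℓ) (hτ : 0 < τ.im) (hη : HasPseudoperiod f τ η) :
    IsDoublyPseudoperiodic f := by
  refine ⟨1, τ, by simpa using hτ, isPseudoperiodicWrt_span hf ?_⟩
  rintro _ (rfl | rfl)
  · exact ⟨ℓ, h⟩
  · exact ⟨η, hη⟩

end DoublyPseudoperiodic

end PseudoPer

theorem theoremA (f : ℂ → OnePoint ℂ) :
    -- projectable via `exp_1` iff non-affine pseudoperiodic with an integer pseudoperiod at `1`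
    (PseudoPer.IsProjectable 1 f ↔
      PseudoPer.IsPseudoperiodic f ∧ ¬ PseudoPer.IsAffine f ∧
        ∃ ℓ : ℤ, PseudoPer.HasPseudoperiod f 1 (ℓ : ℂ)) ∧
    -- existence and uniqueness of the representation
    (PseudoPer.IsProjectable 1 f →
      ∃ (ℓ : ℤ) (Φ : ℂ → OnePoint ℂ),
        PseudoPer.HasPseudoperiod f 1 (ℓ : ℂ) ∧ PseudoPer.HasForm f ℓ Φ ∧
        ∀ (ℓ' : ℤ) (Φ' : ℂ → OnePoint ℂ), PseudoPer.HasForm f ℓ' Φ' →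
          ℓ' = ℓ ∧ Set.EqOn Φ' Φ {0}ᶜ) ∧
    -- the doubly pseudoperiodic case
    (PseudoPer.IsProjectable 1 f →
      ∀ (ℓ : ℤ) (Φ : ℂ → OnePoint ℂ), PseudoPer.HasForm f ℓ Φ →
        (∀ τ : ℂ, 0 < τ.im → ∀ η : ℂ,
          (PseudoPer.HasPseudoperiod f τ η ↔ PseudoPer.HasDoublyForm ℓ Φ τ η)) ∧
        (PseudoPer.IsDoublyPseudoperiodic f ↔
          ∃ τ : ℂ, 0 < τ.im ∧ ∃ η : ℂ, PseudoPer.HasDoublyForm ℓ Φ τ η)) ∧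
    -- projectability in the second direction
    (PseudoPer.IsProjectable 1 f →
      ∀ τ : ℂ, 0 < τ.im → ∀ L : ℤ, PseudoPer.HasPseudoperiod f τ ((L : ℂ) * τ) →
        PseudoPer.IsProjectable τ f) := by
  refine ⟨PseudoPer.isProjectable_one_iff, fun h ↦ ?_, fun h ℓ Φ hΦ ↦ ⟨fun τ hτ η ↦
    hΦ.hasPseudoperiod_iff h.1.1 hτ, fun hd ↦ ?_, ?_⟩, fun h τ hτ L hL ↦ ?_⟩
  · obtain ⟨-, ha, ℓ, hℓ⟩ := PseudoPer.isProjectable_one_iff.mp h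
    obtain ⟨Φ, hΦ⟩ := PseudoPer.exists_hasForm h.1.1 ha hℓ
    exact ⟨ℓ, Φ, hℓ, hΦ, fun ℓ' Φ' h' ↦ hΦ.unique h.1.1 h'⟩
  · obtain ⟨τ, hτ, η, hη⟩ := hd.exists_hasPseudoperiod
    exact ⟨τ, hτ, η, (hΦ.hasPseudoperiod_iff h.1.1 hτ).mp hη⟩
  · rintro ⟨τ, hτ, η, hη⟩
    exact PseudoPer.isDoublyPseudoperiodic_of_hasPseudoperiod h.1.1 hΦ.hasPseudoperiod_one hτ
      ((hΦ.hasPseudoperiod_iff h.1.1 hτ).mpr hη)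
  · exact PseudoPer.isProjectable_of_hasPseudoperiod (by rintro rfl; simp at hτ) h.1 hL
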